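/- Fix a delay $h\ge 0$ and consider $$u_t(t,x)=u_{xx}(t,x)-u(t,x)+g(u(t-h,x)),\quad t>0,\ x\in\mathbb R,\qquad u(s,x)=w_0(s,x),\quad s\in[-h,0],\ x\in\mathbb R. \tag{1}$$ **(H)** $g:\mathbb R_+\to\mathbb R_+$ has exactly two fixed points, $0$ and $\kappa>0$; $|g(u)-g(v)|\le L_g|u-v|$ for $u,v\ge 0$; $g$ is $C^1$ near $0$ and near $\kappa$, with $g'(0)>1$ and $g'(\kappa)<1$; and $|g'(u)-g'(0)|\le Cu^\theta$ on some interval $(0,\delta_0]$, for some $C>0$, $\theta\in(0,1]$. The function $g$ is extended by $g(u)=g'(0)u$ for $u\le 0$. **(UM)** (H) holds with $L_g=g'(0)$, and $g$ is bounded on $\mathbb R_+$ (no monotonicity is required). **(IC1)** $0\le w_0(s,x)\le \sup_{[-h,0]\times\mathbb R} w_0<\infty$ on $[-h,0]\times\mathbb R$. In addition, $w_0$ is continuous, and locally Hölder continuous in $x$ uniformly in $s\in[-h,0]$. The solution $u:[-h,\infty)\times\mathbb R\to\mathbb R_+$ of (1) is meant in the classical sense: $u$ is continuous, bounded on finite time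 intervals, and has continuous derivatives $u_t,u_x,u_{xx}$ in $(0,\infty)\times\mathbb R$. Let $\chi_0(\lambda)=\lambda^2-c\lambda-1+g'(0)e^{-\lambda ch}$. The critical speed $c_\#$ is the unique $c$ for which $\chi_0$ has a double positive zero; for $c>c_\#$, $\chi_0$ has exactly two real zeros $0<\lambda_1(c)<\lambda_2(c)$. A *semi-wavefront* with speed $c$ is a solution $\phi(x+ct)$ of the differential equation in (1), where the profile $\phi:\mathbb R\to(0,\infty)$ is bounded and $C^2$, $\phi(-\infty)=0$ and $\liminf_{x\to+\infty}\phi(x)>0$. It is a *wavefront* if moreover $\phi(+\infty)=\kappa$. Put $\eta_\lambda(x)=\min\{e^{\lambda x},1\}$ and $|f|_\lambda=\sup_{x\in\mathbb R}|f(x)|/\eta_\lambda(x)$. **Theorem.** Assume (UM), let $w_0$ satisfy (IC1), and let $c>c_\#$ and $\lambda\in(\lambda_1(c),\lambda_2(c))$. Let $\phi$ be the profile of a semi-wavefront with speed $c$, and let $u$ be the solution of (1). **A.** If $\sup_{s\in[-h,0]}|\phi(\cdot+cs)-w_0(s,\cdot)|_\lambda<\infty$, then there are $C,\gamma>0$ such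 that $$\sup_{x\in\mathbb R}\frac{|u(t,x)-\phi(x+ct)|}{e^{\lambda(x+ct)}}\le Ce^{-\gamma t},\qquad t\ge 0.$$ **B.** Suppose that, for some $\rho>0$, $g$ is differentiable with $|g'|<1$ at every point of $[\kappa-\rho,\kappa+\rho]$, and that, for some $b\ge 0$, $$\kappa-\rho/4\le w_0(s,x)<\kappa+\rho/4\quad\text{and}\quad \kappa-\rho/4\le\phi(x+cs)<\kappa+\rho/4\qquad\text{for all } x\ge b-ch,\ s\in[-h,0],$$ $$|w_0(s,x)-\phi(x+cs)|\le \tfrac12\rho\, e^{\lambda(x+cs-b)}\qquad\text{for all } x\le b,\ s\in[-h,0].$$ Then $\phi$ is a wavefront, i.e. $\phi(+\infty)=\kappa$, and there is $\gamma>0$ such that $$\sup_{x\in\mathbb R}\frac{|u(t,x)-\phi(x+ct)|}{\eta_\lambda(x+ct)}\le \tfrac12\rho\, e^{-\gamma t},\qquad t\ge 0.$$ -/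

import Mathlib

open Set Filter Topology
open scoped ENNReal

/-- Hypothesis (H), with `L` as the Lipschitz constant `L_g`.  The birth function `g : ℝ₊ → ℝ₊` is
given together with its linear, `C¹`-smooth extension to `(-∞, 0]`, so that `deriv g 0` is
the (one-sided) derivative of the original function at `0`. -/
structure HypH (g : ℝ → ℝ) (κ L : ℝ) : Prop where
  kappa_pos : 0 < κ
  nonneg : ∀ u, 0 ≤ u → 0 ≤ g u
  fixed_iff : ∀ u, 0 ≤ u → (g u = u ↔ u = 0 ∨ u = κ)
  lipschitz : ∀ u v, 0 ≤ u → 0 ≤ v → |g u - g v| ≤ L * |u - v|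
  smooth : ∃ δ > 0,
    ContDiffOn ℝ 1 g (Metric.ball 0 δ) ∧ ContDiffOn ℝ 1 g (Metric.ball κ δ) ∧
    ∃ C > 0, ∃ θ ∈ Ioc (0 : ℝ) 1, ∀ u ∈ Ioc 0 δ, |deriv g u - deriv g 0| ≤ C * u ^ θ
  one_lt_deriv_zero : 1 < deriv g 0
  deriv_kappa_lt_one : deriv g κ < 1
  extension : ∀ u, u ≤ 0 → g u = deriv g 0 * u

/-- Hypothesis (UM): (H) holds with `L_g = g'(0)`, and `g` is bounded on `ℝ₊`. -/
structure HypUM (g : ℝ → ℝ) (κ : ℝ) : Prop where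
  hypH : HypH g κ (deriv g 0)
  bounded : ∃ M, ∀ u, 0 ≤ u → g u ≤ M

/-- The characteristic function at the equilibrium `0`, `p` standing for `g'(0)`:
`χ₀(l) = l² - c l - 1 + p exp (-l c h)`. -/
noncomputable def charFun0 (p h c l : ℝ) : ℝ :=
  l ^ 2 - c * l - 1 + p * Real.exp (-(l * c * h))

/-- The critical speed `c_#`: the (unique, if `p > 1` and `h ≥ 0`) value of `c` for which `χ₀` has
a double positive zero. -/
noncomputable def criticalSpeed (p h : ℝ) : ℝ :=
  sInf {c | ∃ l, 0 < l ∧ charFun0 p h c l = 0 ∧ deriv (charFun0 p h c) l = 0}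

/-- `λ₁(c)`: the smaller one of the two (positive) real zeros of `χ₀`. -/
noncomputable def lambda1 (p h c : ℝ) : ℝ := sInf {l | 0 < l ∧ charFun0 p h c l = 0}

/-- `λ₂(c)`: the larger one of the two (positive) real zeros of `χ₀`. -/
noncomputable def lambda2 (p h c : ℝ) : ℝ := sSup {l | 0 < l ∧ charFun0 p h c l = 0}

/-- The weight `η_l(x) = min {exp (l x), 1}`. -/
noncomputable def etaWeight (l x : ℝ) : ℝ := min (Real.exp (l * x)) 1

/-- The weighted norm `|f|_l = sup |f(x)| / η_l(x)` over all real `x`, with values in `[0, ∞]`. -/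
noncomputable def lamNorm (l : ℝ) (f : ℝ → ℝ) : ℝ≥0∞ :=
  ⨆ x : ℝ, ENNReal.ofReal (|f x| / etaWeight l x)

/-- Admissible initial functions `w₀ : [-h, 0] × ℝ → ℝ₊`: continuous, nonnegative and bounded
(this is (IC1)), and locally Hölder continuous in `x`, uniformly in `s`. -/
structure IsInitialDatum (h : ℝ) (w₀ : ℝ → ℝ → ℝ) : Prop where
  continuousOn : ContinuousOn (fun p : ℝ × ℝ => w₀ p.1 p.2) (Icc (-h) 0 ×ˢ univ)
  nonneg : ∀ s ∈ Icc (-h) 0, ∀ x, 0 ≤ w₀ s x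
  bounded : ∃ M, ∀ s ∈ Icc (-h) 0, ∀ x, w₀ s x ≤ M
  holder : ∀ R > 0, ∃ C, ∃ α ∈ Ioc (0 : ℝ) 1, ∀ s ∈ Icc (-h) 0,
    ∀ x ∈ Icc (-R) R, ∀ y ∈ Icc (-R) R, |w₀ s x - w₀ s y| ≤ C * |x - y| ^ α

/-- `u : [-h, ∞) × ℝ → ℝ₊` is a classical solution of
`u_t(t,x) = u_xx(t,x) - u(t,x) + g(u(t-h,x))`, `t > 0`, with `u = w₀` on `[-h, 0] × ℝ`:
it is continuous, bounded on finite time intervals, and has continuous derivatives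
`u_t`, `u_x`, `u_xx` in `(0, ∞) × ℝ`. -/
structure IsClassicalSolution (h : ℝ) (g : ℝ → ℝ) (w₀ u : ℝ → ℝ → ℝ) : Prop where
  nonneg : ∀ t, -h ≤ t → ∀ x, 0 ≤ u t x
  continuousOn : ContinuousOn (fun p : ℝ × ℝ => u p.1 p.2) (Ici (-h) ×ˢ univ)
  bounded : ∀ T, ∃ M, ∀ t ∈ Icc (-h) T, ∀ x, u t x ≤ M
  diff_t : ∀ t, 0 < t → ∀ x, DifferentiableAt ℝ (fun τ => u τ x) t
  diff_x : ∀ t, 0 < t → ∀ x, DifferentiableAt ℝ (u t) x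
  diff_xx : ∀ t, 0 < t → ∀ x, DifferentiableAt ℝ (deriv (u t)) x
  cont_t : ContinuousOn (fun p : ℝ × ℝ => deriv (fun τ => u τ p.2) p.1) (Ioi 0 ×ˢ univ)
  cont_x : ContinuousOn (fun p : ℝ × ℝ => deriv (u p.1) p.2) (Ioi 0 ×ˢ univ)
  cont_xx : ContinuousOn (fun p : ℝ × ℝ => deriv (deriv (u p.1)) p.2) (Ioi 0 ×ˢ univ)
  equation : ∀ t, 0 < t → ∀ x,
    deriv (fun τ => u τ x) t = deriv (deriv (u t)) x - u t x + g (u (t - h) x)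
  initial : ∀ s ∈ Icc (-h) 0, ∀ x, u s x = w₀ s x

/-- `φ` is a positive bounded `C²` profile with `φ(-∞) = 0` for which `φ(x + c t)` solves the
delayed equation, i.e. `φ''(z) - c φ'(z) - φ(z) + g(φ(z - c h)) = 0` on `ℝ`. -/
structure IsWaveProfile (g : ℝ → ℝ) (h c : ℝ) (φ : ℝ → ℝ) : Prop where
  contDiff : ContDiff ℝ 2 φ
  pos : ∀ z, 0 < φ z
  bounded : ∃ M, ∀ z, φ z ≤ M
  equation : ∀ z, deriv (deriv φ) z - c * deriv φ z - φ z + g (φ (z - c * h)) = 0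
  tendsto_atBot : Tendsto φ atBot (𝓝 0)

/-- Semi-wavefront (profile): a wave profile with `liminf φ > 0` at `+∞`. -/
structure IsSemiWavefront (g : ℝ → ℝ) (h c : ℝ) (φ : ℝ → ℝ) : Prop
    extends IsWaveProfile g h c φ where
  liminf_pos : 0 < liminf φ atTop

/-- Wavefront (profile): a wave profile with `φ(+∞) = κ`. -/
structure IsWavefront (g : ℝ → ℝ) (h c κ : ℝ) (φ : ℝ → ℝ) : Prop
    extends IsWaveProfile g h c φ where
  tendsto_atTop : Tendsto φ atTop (𝓝 κ)

/-!
The profile `φ` and the solution `u` are compared through `|u - φ(x + c t)|`, a subsolution of the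
equation linearised with the Lipschitz constants of `g`. All decay comes from explicit
supersolutions. The comparison is `abs_sub_wave_le_of_supersolution`, which rests on a maximum
principle on the whole line for bounded functions (`maximum_principle`). Two features make it
convenient. It is stated in the viscosity sense, so that absolute values and minima of
supersolutions are allowed. And since the delayed term sits at the same point `x` at an earlier
time, at a first touching of a barrier increasing in time its excess is dominated by the present
one, so that `h = 0` and `h > 0` are treated alike, without stepping through intervals of length
`h`.

For part A the supersolution is `A e^{l z} e^{-γ t}` with `z = x + c t`. It works on all of `ℝ`
because `g` is Lipschitz with constant `g'(0)` and `χ₀(l) < 0` strictly between the zeros of the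
convex function `χ₀` (`charFun0_neg`), which leaves room for a small `γ > 0`.

For part B, `φ → κ` follows by iteration (`tendsto_kappa_of_contraction`): `|g a - κ| ≤ ℓ |a - κ|`
with some `ℓ < 1` on the interval in which `φ` eventually lies, and bounded solutions of
`y'' - c y' - y + f = 0` inherit the asymptotic bounds of `f`. The supersolution is
`(ρ / 2) e^{-γ t} min (e^{l (z - b)}, θ(z))`. As `g'` need not be continuous, the Lipschitz constant
of `g` on `[κ - ρ, κ + ρ]` may equal `1`, and a constant plateau `θ` gives no decay. A uniform contraction is
available only where `φ` is already close to `κ`, that is for large `z`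
(`exists_contraction_near_kappa`); on the remaining bounded range, a slightly increasing concave
`θ` gains from the drift term `- c θ'`. The room for a `θ` that is smaller than `1` comes from
compactness: the strict bounds on the initial data yield `|w₀ - φ| ≤ (1 - δ) ρ / 2`
(`exists_uniform_gap`).
-/

/-! ### Second-order tests at a maximum -/

theorem second_deriv_nonpos_of_isLocalMax {f f' : ℝ → ℝ} {f'' x : ℝ}
    (hf : ∀ y, HasDerivAt f (f' y) y) (hf' : HasDerivAt f' f'' x) (hmax : IsLocalMax f x) :
    f'' ≤ 0 := by
  by_contra! hpos
  have hd : deriv f = f' := funext fun y => (hf y).deriv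
  have hmin : IsLocalMin f x := by
    refine isLocalMin_of_deriv_deriv_pos ?_ ?_ (hf x).continuousAt
    · rw [hd, hf'.deriv]; exact hpos
    · rw [hd]; exact hmax.hasDerivAt_eq_zero (hf x)
  have hconst : f =ᶠ[𝓝 x] fun _ => f x := by
    filter_upwards [hmax, hmin] with y h1 h2 using le_antisymm h1 h2
  have hzero : deriv (deriv f) x = 0 := by
    rw [hconst.deriv.deriv_eq]; simp
  rw [hd, hf'.deriv] at hzero
  exact hpos.ne' hzero

theorem deriv_nonneg_of_le_left {f : ℝ → ℝ} {f' a t : ℝ} (hat : a < t) (hf : HasDerivAt f f' t)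
    (hle : ∀ s ∈ Icc a t, f s ≤ f t) : 0 ≤ f' := by
  have hs := (hasDerivWithinAt_iff_tendsto_slope' (s := Iio t) (by simp)).1 hf.hasDerivWithinAt
  refine ge_of_tendsto hs ?_
  filter_upwards [Ioo_mem_nhdsLT hat] with s hs
  rw [slope_def_field]
  exact div_nonneg_of_nonpos (by linarith [hle s ⟨hs.1.le, hs.2.le⟩]) (by linarith [hs.2])

/-! ### The maximum principle and comparison with a wave -/

/-- Maximum principle on `[0, T] × ℝ` for functions bounded above. The differential inequality is
only required in the viscosity sense (for a function `y` touching `Z` from below), which covers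
maxima of smooth functions such as `|w| - min W₁ W₂`, and only at points where `Z` exceeds its own
past at the same place, which lets a delayed term `p * Z (t - h) x` be absorbed for every `h ≥ 0`,
with no time stepping. -/
theorem maximum_principle {Z : ℝ → ℝ → ℝ} {p T : ℝ} (hp : 0 ≤ p)
    (hcont : ContinuousOn (fun q : ℝ × ℝ => Z q.1 q.2) (Icc 0 T ×ˢ univ))
    (hbdd : ∃ M, ∀ t ∈ Icc 0 T, ∀ x, Z t x ≤ M) (hinit : ∀ x, Z 0 x ≤ 0)
    (htouch : ∀ t ∈ Ioc 0 T, ∀ x, 0 < Z t x → (∀ s ∈ Icc 0 t, Z s x ≤ Z t x) →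
      ∃ (y : ℝ → ℝ → ℝ) (yx : ℝ → ℝ) (yt yxx : ℝ),
        (∀ s ∈ Icc 0 t, ∀ x', y s x' ≤ Z s x') ∧ y t x = Z t x ∧
        HasDerivAt (fun s => y s x) yt t ∧ (∀ x', HasDerivAt (y t) (yx x') x') ∧
        HasDerivAt yx yxx x ∧ yt - yxx ≤ p * Z t x) :
    ∀ t ∈ Icc 0 T, ∀ x, Z t x ≤ 0 := by
  intro t₀ ht₀ x₀
  by_contra! hpos
  obtain ⟨M, hM⟩ := hbdd
  -- The barrier `ε e^{(p + 3) t} (1 + x²)`, with `ε` so small that `Z` exceeds it at `(t₀, x₀)`.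
  obtain ⟨ε, hε, hε₀⟩ : ∃ ε > 0, ε * (Real.exp ((p + 3) * t₀) * (1 + x₀ ^ 2)) ≤ Z t₀ x₀ :=
    ⟨Z t₀ x₀ / (Real.exp ((p + 3) * t₀) * (1 + x₀ ^ 2)), by positivity,
      (div_mul_cancel₀ _ (by positivity)).le⟩
  set β : ℝ → ℝ → ℝ := fun t x => ε * (Real.exp ((p + 3) * t) * (1 + x ^ 2)) with hβ
  have hβc : Continuous (fun q : ℝ × ℝ => β q.1 q.2) := by fun_prop
  have hβpos : ∀ t x, 0 < β t x := fun t x => by simp only [hβ]; positivity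
  have hβmono : ∀ x s t, s ≤ t → β s x ≤ β t x := fun x s t hst => by
    simp only [hβ]; gcongr
  have hβlow : ∀ t ∈ Icc 0 T, ∀ x, ε * (1 + x ^ 2) ≤ β t x := fun t ht x => by
    have : (1 : ℝ) ≤ Real.exp ((p + 3) * t) := Real.one_le_exp (by have := ht.1; positivity)
    simp only [hβ]
    gcongr
    nlinarith [sq_nonneg x]
  set S : Set (ℝ × ℝ) := {q ∈ Icc 0 T ×ˢ univ | 0 ≤ Z q.1 q.2 - β q.1 q.2} with hS
  have hSclosed : IsClosed S := by
    have := (hcont.sub hβc.continuousOn).preimage_isClosed_of_isClosed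
      (isClosed_Icc.prod isClosed_univ) (isClosed_Ici (a := (0 : ℝ)))
    exact this
  have hSbdd : S ⊆ Icc 0 T ×ˢ Icc (-(M / ε + 1)) (M / ε + 1) := by
    rintro ⟨t, x⟩ ⟨⟨ht, -⟩, hx⟩
    simp only at hx ht
    have h1 := hβlow t ht x
    have h2 := hM t ht x
    have h3 : 1 + x ^ 2 ≤ M / ε := by rw [le_div_iff₀ hε]; linarith
    refine ⟨ht, abs_le.1 (abs_le_of_sq_le_sq ?_ ?_)⟩ <;> nlinarith [sq_nonneg x]
  have hScomp : IsCompact S :=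
    (isCompact_Icc.prod isCompact_Icc).of_isClosed_subset hSclosed hSbdd
  obtain ⟨⟨t, x⟩, ⟨⟨ht, -⟩, hx⟩, hmin⟩ := hScomp.exists_isMinOn
    ⟨(t₀, x₀), ⟨ht₀, mem_univ _⟩, sub_nonneg.2 hε₀⟩ continuous_fst.continuousOn
  simp only at hx ht
  have htpos : 0 < t := by
    rcases ht.1.eq_or_lt with h0 | h0
    · have := hinit x
      rw [h0] at this
      linarith [hβpos t x]
    · exact h0
  have hbefore : ∀ s ∈ Ico 0 t, ∀ x', Z s x' < β s x' := by
    intro s hs x'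
    by_contra! hcon
    have := hmin (show (s, x') ∈ S from ⟨⟨⟨hs.1, hs.2.le.trans ht.2⟩, mem_univ _⟩, by simpa using hcon⟩)
    simp only [mem_ofPred_eq] at this
    linarith [hs.2]
  have hle : ∀ s ∈ Icc 0 t, ∀ x', Z s x' ≤ β s x' := by
    intro s hs x'
    rcases hs.2.eq_or_lt with rfl | hlt
    · have hc1 : ContinuousOn (fun r => Z r x' - β r x') (Icc 0 T) :=
        (hcont.sub hβc.continuousOn).comp (f := fun r : ℝ => (r, x'))
          (by fun_prop) (fun r hr => ⟨hr, mem_univ _⟩)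
      have hc2 := (hc1 s ht).mono_left (nhdsWithin_mono s (s := Ico 0 s)
        fun r hr => ⟨hr.1, hr.2.le.trans ht.2⟩)
      have : (𝓝[Ico 0 s] s).NeBot := by
        rw [nhdsWithin_Ico_eq_nhdsLT htpos]; infer_instance
      refine sub_nonpos.1 (le_of_tendsto hc2 ?_)
      filter_upwards [self_mem_nhdsWithin] with r hr
      linarith [hbefore r hr x']
    · exact (hbefore s ⟨hs.1, hlt⟩ x').le
  have heq : Z t x = β t x := le_antisymm (hle t ⟨ht.1, le_rfl⟩ x) (by linarith)
  obtain ⟨y, yx, yt, yxx, hy, hyt, hdt, hdx, hdxx, hineq⟩ := htouch t ⟨htpos, ht.2⟩ x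
    (heq ▸ hβpos t x) fun s hs => by
      rw [heq]; exact (hle s hs x).trans (hβmono x s t hs.2)
  have hβt : HasDerivAt (fun s => β s x) ((p + 3) * β t x) t := by
    have := ((((hasDerivAt_id t).const_mul (p + 3)).exp).mul_const (1 + x ^ 2)).const_mul ε
    refine this.congr_deriv ?_
    simp only [hβ, id, mul_one]; ring
  have hβx : ∀ x', HasDerivAt (β t) (ε * (Real.exp ((p + 3) * t) * (2 * x'))) x' := fun x' => by
    have := ((((hasDerivAt_id x').pow 2).const_add 1).const_mul (Real.exp ((p + 3) * t))).const_mul ε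
    refine this.congr_deriv ?_
    simp
  have hβxx : HasDerivAt (fun x' => ε * (Real.exp ((p + 3) * t) * (2 * x')))
      (ε * (Real.exp ((p + 3) * t) * 2)) x := by
    have := (((hasDerivAt_id x).const_mul 2).const_mul (Real.exp ((p + 3) * t))).const_mul ε
    refine this.congr_deriv ?_
    simp
  have ht' : 0 ≤ yt - (p + 3) * β t x :=
    deriv_nonneg_of_le_left htpos (hdt.sub hβt) fun s hs => by
      have := (hy s hs x).trans (hle s hs x)
      simp only [Pi.sub_apply]
      linarith
  have hx' : yxx - ε * (Real.exp ((p + 3) * t) * 2) ≤ 0 :=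
    second_deriv_nonpos_of_isLocalMax (fun x' => (hdx x').sub (hβx x')) (hdxx.sub hβxx)
      (Eventually.of_forall fun x' => by
        have := (hy t ⟨ht.1, le_rfl⟩ x').trans (hle t ⟨ht.1, le_rfl⟩ x')
        simp only [Pi.sub_apply]
        linarith)
  have hbig : ε * (Real.exp ((p + 3) * t) * 2) ≤ 2 * β t x := by
    simp only [hβ]
    have : 0 ≤ ε * Real.exp ((p + 3) * t) * x ^ 2 := by positivity
    nlinarith
  rw [heq] at hineq
  linarith [hβpos t x]

/-- Comparison of a solution with a travelling wave: `W` bounds `|u - φ(x + c t)|` if it does so at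
`t = 0` and at each point is touched from above by a smooth `V` for which `V_t - V_xx + V` dominates
the reaction difference. The excess `K` of `|u - φ|` over `W` may enter the reaction term linearly;
the premise `h ≤ t` leaves the estimate on the initial strip to the user. -/
theorem abs_sub_wave_le_of_supersolution {h c p : ℝ} {g φ : ℝ → ℝ} {w₀ u : ℝ → ℝ → ℝ}
    (hh : 0 ≤ h) (hp : 0 ≤ p) (hu : IsClassicalSolution h g w₀ u) (hφ : IsWaveProfile g h c φ)
    {W : ℝ → ℝ → ℝ} (hWc : Continuous (fun q : ℝ × ℝ => W q.1 q.2)) (hW0 : ∀ t x, 0 ≤ W t x)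
    (hinit : ∀ x, |u 0 x - φ x| ≤ W 0 x)
    (htouch : ∀ t > 0, ∀ x, ∃ (V : ℝ → ℝ → ℝ) (Vx : ℝ → ℝ) (Vt Vxx Q : ℝ),
      (∀ s x', W s x' ≤ V s x') ∧ V t x = W t x ∧
      HasDerivAt (fun s => V s x) Vt t ∧ (∀ x', HasDerivAt (V t) (Vx x') x') ∧
      HasDerivAt Vx Vxx x ∧ Q ≤ Vt - Vxx + W t x ∧
      ∀ K ≥ 0, (h ≤ t → |u (t - h) x - φ (x + c * (t - h))| ≤ W (t - h) x + K) →
        |g (u (t - h) x) - g (φ (x + c * (t - h)))| ≤ Q + p * K) :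
    ∀ t, 0 ≤ t → ∀ x, |u t x - φ (x + c * t)| ≤ W t x := by
  intro T hT x
  have hφ1 : ∀ z, HasDerivAt φ (deriv φ z) z := fun z =>
    (hφ.contDiff.differentiable (by norm_num) z).hasDerivAt
  have hφ2 : ∀ z, HasDerivAt (deriv φ) (deriv (deriv φ) z) z := fun z =>
    ((contDiff_succ_iff_deriv (n := 1).1 hφ.contDiff).2.2.differentiable (by norm_num) z).hasDerivAt
  have hφc : Continuous φ := hφ.contDiff.continuous
  have huc : ContinuousOn (fun q : ℝ × ℝ => u q.1 q.2) (Icc 0 T ×ˢ univ) :=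
    hu.continuousOn.mono (prod_mono (fun s hs => by simp only [mem_Ici]; linarith [hs.1]) le_rfl)
  have key := maximum_principle (Z := fun t x => |u t x - φ (x + c * t)| - W t x) (T := T) hp
    ((huc.sub (by fun_prop)).abs.sub hWc.continuousOn) ?_ ?_ ?_ T ⟨hT, le_rfl⟩ x
  · simpa using key
  · obtain ⟨M₁, hM₁⟩ := hu.bounded T
    obtain ⟨M₂, hM₂⟩ := hφ.bounded
    refine ⟨M₁ + M₂, fun t ht x => ?_⟩
    have h1 := hM₁ t ⟨by linarith [ht.1], ht.2⟩ x
    have h2 := hu.nonneg t (by linarith [ht.1]) x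
    have h3 := hM₂ (x + c * t)
    have h4 := hφ.pos (x + c * t)
    have h5 := hW0 t x
    have : |u t x - φ (x + c * t)| ≤ M₁ + M₂ := abs_le.2 ⟨by linarith, by linarith⟩
    linarith
  · intro x
    simpa using hinit x
  · intro t ht x hpos hpast
    obtain ⟨V, Vx, Vt, Vxx, Q, hWV, hVW, hVt, hVx, hVxx, hQ, hreac⟩ := htouch t ht.1 x
    have hK := hreac _ hpos.le fun hht => by
      have := hpast (t - h) ⟨by linarith, by linarith⟩
      linarith
    have hut := (hu.diff_t t ht.1 x).hasDerivAt
    have hux := fun x' => (hu.diff_x t ht.1 x').hasDerivAt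
    have huxx := (hu.diff_xx t ht.1 x).hasDerivAt
    have hequ := hu.equation t ht.1 x
    have heqφ := hφ.equation (x + c * t)
    rw [show x + c * t - c * h = x + c * (t - h) by ring] at heqφ
    have hφt : HasDerivAt (fun s => φ (x + c * s)) (deriv φ (x + c * t) * c) t :=
      (hφ1 (x + c * t)).comp t
        ((((hasDerivAt_id t).const_mul c).const_add x).congr_deriv (by simp))
    have hφx : ∀ x', HasDerivAt (fun x' => φ (x' + c * t)) (deriv φ (x' + c * t)) x' := fun x' =>
      (hφ1 (x' + c * t)).comp_add_const x' (c * t)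
    have hφxx : HasDerivAt (fun x' => deriv φ (x' + c * t)) (deriv (deriv φ) (x + c * t)) x :=
      (hφ2 (x + c * t)).comp_add_const x (c * t)
    -- `σ` is the sign of `u - φ` at the touching point, so that `|u - φ| ≥ σ (u - φ)`.
    obtain ⟨σ, hσ, hσeq⟩ : ∃ σ : ℝ, |σ| = 1 ∧
        |u t x - φ (x + c * t)| = σ * (u t x - φ (x + c * t)) := by
      rcases abs_cases (u t x - φ (x + c * t)) with ⟨h1, -⟩ | ⟨h1, -⟩
      · exact ⟨1, by simp, by simpa using h1⟩
      · exact ⟨-1, by simp, by simpa using h1⟩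
    have hσle : ∀ r, σ * r ≤ |r| := fun r => by
      have := le_abs_self (σ * r)
      rwa [abs_mul, hσ, one_mul] at this
    refine ⟨fun s x' => σ * (u s x' - φ (x' + c * s)) - V s x', _, _, _, ?_, ?_,
      ((hut.sub hφt).const_mul σ).sub hVt,
      fun x' => (((hux x').sub (hφx x')).const_mul σ).sub (hVx x'),
      ((huxx.sub hφxx).const_mul σ).sub hVxx, ?_⟩
    · intro s _ x'
      linarith [hσle (u s x' - φ (x' + c * s)), hWV s x']
    · simp only [hVW, hσeq]
    · have h1 := hσle (g (u (t - h) x) - g (φ (x + c * (t - h))))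
      rw [hequ]
      have h2 : deriv φ (x + c * t) * c = deriv (deriv φ) (x + c * t) - φ (x + c * t)
          + g (φ (x + c * (t - h))) := by linarith
      rw [h2]
      linarith

/-! ### The characteristic function -/

theorem criticalSpeed_nonneg {p h : ℝ} (hp : 0 ≤ p) (hh : 0 ≤ h) : 0 ≤ criticalSpeed p h := by
  refine Real.sInf_nonneg ?_
  rintro c ⟨l, hl, -, hd⟩
  have h1 : HasDerivAt (charFun0 p h c)
      (2 * l - c + p * (Real.exp (-(l * c * h)) * -(c * h))) l := by
    have e : HasDerivAt (fun l : ℝ => -(l * c * h)) (-(c * h)) l :=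
      ((((hasDerivAt_id l).mul_const c).mul_const h).neg).congr_deriv (by simp)
    have := ((((hasDerivAt_id l).pow 2).sub ((hasDerivAt_id l).const_mul c)).sub_const 1).add
      (e.exp.const_mul p)
    exact this.congr_deriv (by simp)
  rw [h1.deriv] at hd
  by_contra! hc
  have : 0 ≤ p * (Real.exp (-(l * c * h)) * -(c * h)) := by
    have : 0 ≤ -(c * h) := by nlinarith
    positivity
  linarith

/-- Between its two zeros the strictly convex function `χ₀` is negative. -/
theorem charFun0_neg {p h c l : ℝ} (hp : 0 ≤ p) (hl : l ∈ Ioo (lambda1 p h c) (lambda2 p h c)) :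
    0 < l ∧ charFun0 p h c l < 0 := by
  have hne : {l | 0 < l ∧ charFun0 p h c l = 0}.Nonempty := by
    by_contra hemp
    rw [not_nonempty_iff_eq_empty] at hemp
    have h1 := hl.1
    have h2 := hl.2
    rw [lambda1, hemp, Real.sInf_empty] at h1
    rw [lambda2, hemp, Real.sSup_empty] at h2
    linarith
  obtain ⟨a, ⟨ha0, ha⟩, hal⟩ := exists_lt_of_csInf_lt hne hl.1
  obtain ⟨b, ⟨-, hb⟩, hlb⟩ := exists_lt_of_lt_csSup hne hl.2
  have hconv : StrictConvexOn ℝ univ (charFun0 p h c) := by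
    have h1 : StrictConvexOn ℝ univ fun l : ℝ => l ^ 2 := Even.strictConvexOn_pow even_two (by norm_num)
    have h2 : ConvexOn ℝ univ fun l : ℝ => p * Real.exp (-(l * c * h)) - c * l - 1 := by
      have e : ConvexOn ℝ univ fun l : ℝ => Real.exp (-(l * c * h)) := by
        have := convexOn_exp.comp_linearMap ((-(c * h)) • LinearMap.id (R := ℝ) (M := ℝ))
        refine this.congr fun x _ => ?_
        simp only [Function.comp, LinearMap.smul_apply, LinearMap.id_apply, smul_eq_mul]
        congr 1; ring
      have h3 : ConvexOn ℝ univ fun l : ℝ => -c * l - 1 :=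
        ⟨convex_univ, fun x _ y _ s t _ _ hst => by
          simp only [smul_eq_mul]
          have : s = 1 - t := by linarith
          subst this
          apply le_of_eq; ring⟩
      refine ((e.smul hp).add h3).congr fun x _ => ?_
      simp only [Pi.add_apply, smul_eq_mul]; ring
    refine (h1.add_convexOn h2).congr fun x _ => ?_
    simp only [Pi.add_apply, charFun0]; ring
  refine ⟨ha0.trans hal, ?_⟩
  have hab : a < b := hal.trans hlb
  have hba : b - a ≠ 0 := by linarith
  have hs : 0 < (b - l) / (b - a) := div_pos (by linarith) (by linarith)
  have ht : 0 < (l - a) / (b - a) := div_pos (by linarith) (by linarith)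
  have hst : (b - l) / (b - a) + (l - a) / (b - a) = 1 := by field_simp; ring
  have := hconv.2 (mem_univ a) (mem_univ b) hab.ne hs ht hst
  rw [ha, hb] at this
  have e : ((b - l) / (b - a)) • a + ((l - a) / (b - a)) • b = l := by
    simp only [smul_eq_mul]; field_simp; ring
  rw [e] at this
  simpa using this

/-- The strict inequality `χ₀(l) < 0` leaves room for a small temporal decay rate. -/
theorem eventually_supersolution_rate {p h c l : ℝ} (hneg : charFun0 p h c l < 0) :
    ∀ᶠ γ in 𝓝[>] (0 : ℝ),
      p * Real.exp (-(l * c * h)) * Real.exp (γ * h) ≤ l * c - γ - l ^ 2 + 1 := by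
  have : Tendsto (fun γ : ℝ => l * c - γ - l ^ 2 + 1 -
      p * Real.exp (-(l * c * h)) * Real.exp (γ * h)) (𝓝 0) (𝓝 (-charFun0 p h c l)) := by
    have hc : Continuous (fun γ : ℝ => l * c - γ - l ^ 2 + 1 -
      p * Real.exp (-(l * c * h)) * Real.exp (γ * h)) := by fun_prop
    convert hc.tendsto 0 using 2
    simp [charFun0]; ring
  filter_upwards [(this.mono_left nhdsWithin_le_nhds).eventually_const_le (neg_pos.2 hneg)] with γ hγ
  linarith

/-! ### Stability in the exponential weight -/

/-- Derivatives of the exponential supersolution `A e^{l (x + c t - b)} e^{-γ t}`. -/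
theorem hasDerivAt_expWave (A l c b γ t x : ℝ) :
    HasDerivAt (fun s => A * Real.exp (-(γ * s)) * Real.exp (l * (x + c * s - b)))
      ((l * c - γ) * (A * Real.exp (-(γ * t)) * Real.exp (l * (x + c * t - b)))) t ∧
    (∀ x', HasDerivAt (fun x' => A * Real.exp (-(γ * t)) * Real.exp (l * (x' + c * t - b)))
      (A * Real.exp (-(γ * t)) * Real.exp (l * (x' + c * t - b)) * l) x') ∧
    HasDerivAt (fun x' => A * Real.exp (-(γ * t)) * Real.exp (l * (x' + c * t - b)) * l)
      (l ^ 2 * (A * Real.exp (-(γ * t)) * Real.exp (l * (x + c * t - b)))) x := by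
  have hx : ∀ x', HasDerivAt
      (fun x' => A * Real.exp (-(γ * t)) * Real.exp (l * (x' + c * t - b)))
      (A * Real.exp (-(γ * t)) * Real.exp (l * (x' + c * t - b)) * l) x' := fun x' => by
    have e : HasDerivAt (fun x' => l * (x' + c * t - b)) l x' :=
      ((((hasDerivAt_id x').add_const (c * t)).sub_const b).const_mul l).congr_deriv (by simp)
    exact (e.exp.const_mul _).congr_deriv (by ring)
  refine ⟨?_, hx, ((hx x).mul_const l).congr_deriv (by ring)⟩
  have e1 : HasDerivAt (fun s => -(γ * s)) (-γ) t :=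
    (((hasDerivAt_id t).const_mul γ).neg).congr_deriv (by simp)
  have e2 : HasDerivAt (fun s => l * (x + c * s - b)) (l * c) t :=
    (((((hasDerivAt_id t).const_mul c).const_add x).sub_const b).const_mul l).congr_deriv (by simp)
  exact ((e1.exp.const_mul A).mul e2.exp).congr_deriv (by ring)

/-- Delaying the exponential supersolution costs the factor `e^{-l c h} e^{γ h}`. -/
theorem expWave_delay (A l c b γ h t x : ℝ) :
    A * Real.exp (-(γ * (t - h))) * Real.exp (l * (x + c * (t - h) - b)) =
      Real.exp (-(l * c * h)) * Real.exp (γ * h) *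
        (A * Real.exp (-(γ * t)) * Real.exp (l * (x + c * t - b))) := by
  rw [show -(γ * (t - h)) = γ * h + -(γ * t) by ring,
    show l * (x + c * (t - h) - b) = -(l * c * h) + l * (x + c * t - b) by ring,
    Real.exp_add, Real.exp_add]
  ring

theorem bound_of_iSup_lamNorm_lt_top {h l : ℝ} {f : ℝ → ℝ → ℝ}
    (hfin : (⨆ s ∈ Icc (-h) 0, lamNorm l (f s)) < ⊤) :
    ∃ M, 0 ≤ M ∧ ∀ s ∈ Icc (-h) 0, ∀ x, |f s x| ≤ M * Real.exp (l * x) := by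
  refine ⟨(⨆ s ∈ Icc (-h) 0, lamNorm l (f s)).toReal, ENNReal.toReal_nonneg, fun s hs x => ?_⟩
  have hη : 0 < etaWeight l x := lt_min (Real.exp_pos _) one_pos
  have h1 : ENNReal.ofReal (|f s x| / etaWeight l x) ≤ ⨆ s ∈ Icc (-h) 0, lamNorm l (f s) :=
    (le_iSup (fun x => ENNReal.ofReal (|f s x| / etaWeight l x)) x).trans
      (le_iSup₂ (f := fun s (_ : s ∈ Icc (-h) 0) => lamNorm l (f s)) s hs)
  have h2 := (ENNReal.ofReal_le_iff_le_toReal hfin.ne).1 h1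
  rw [div_le_iff₀ hη] at h2
  exact h2.trans (mul_le_mul_of_nonneg_left (min_le_left _ _) ENNReal.toReal_nonneg)

/-- Global stability in the weight `e^{l x}`: since `g` is Lipschitz with constant `g'(0)`, the
exponential `A e^{l (x + c t)} e^{-γ t}` is a supersolution for `|u - φ|` on the whole line. -/
theorem exponential_stability {h κ c l : ℝ} {g φ : ℝ → ℝ} {w₀ u : ℝ → ℝ → ℝ}
    (hh : 0 ≤ h) (hg : HypUM g κ) (hc : 0 < c) (hl : 0 < l)
    (hneg : charFun0 (deriv g 0) h c l < 0)
    (hφ : IsWaveProfile g h c φ) (hu : IsClassicalSolution h g w₀ u)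
    (hfin : (⨆ s ∈ Icc (-h) 0, lamNorm l (fun x => φ (x + c * s) - w₀ s x)) < ⊤) :
    ∃ C > 0, ∃ γ > 0, ∀ t, 0 ≤ t → ∀ x,
      |u t x - φ (x + c * t)| / Real.exp (l * (x + c * t)) ≤ C * Real.exp (-(γ * t)) := by
  have hp : 0 ≤ deriv g 0 := by linarith [hg.hypH.one_lt_deriv_zero]
  obtain ⟨M, hM0, hM⟩ := bound_of_iSup_lamNorm_lt_top hfin
  obtain ⟨γ, hrate, hγ⟩ := ((eventually_supersolution_rate hneg).and self_mem_nhdsWithin).exists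
  replace hγ : 0 < γ := hγ
  set A := (M + 1) * Real.exp (l * c * h) with hA
  have hA0 : 0 < A := by positivity
  set W : ℝ → ℝ → ℝ := fun t x => A * Real.exp (-(γ * t)) * Real.exp (l * (x + c * t - 0)) with hW
  have hWpos : ∀ t x, 0 < W t x := fun t x => by simp only [hW]; positivity
  have hstrip : ∀ s ∈ Icc (-h) 0, ∀ x, |u s x - φ (x + c * s)| ≤ W s x := by
    intro s hs x
    have h1 := hM s hs x
    rw [abs_sub_comm, ← hu.initial s hs x] at h1
    refine h1.trans ?_
    have h2 : (1 : ℝ) ≤ Real.exp (-(γ * s)) := Real.one_le_exp (by nlinarith [hs.2])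
    have h3 : Real.exp (l * x) ≤ Real.exp (l * c * h) * Real.exp (l * (x + c * s - 0)) := by
      rw [← Real.exp_add]
      refine Real.exp_le_exp.2 ?_
      nlinarith [mul_nonneg (mul_pos hl hc).le (by linarith [hs.1] : 0 ≤ h + s)]
    calc M * Real.exp (l * x)
        ≤ (M + 1) * (Real.exp (l * c * h) * Real.exp (l * (x + c * s - 0))) := by
          gcongr; linarith
      _ = A * 1 * Real.exp (l * (x + c * s - 0)) := by rw [hA]; ring
      _ ≤ W s x := by simp only [hW]; gcongr
  refine ⟨A, hA0, γ, hγ, fun t ht x => ?_⟩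
  rw [div_le_iff₀ (Real.exp_pos _)]
  have := abs_sub_wave_le_of_supersolution (W := W) hh hp hu hφ (by fun_prop)
    (fun t x => (hWpos t x).le) (fun x => by simpa using hstrip 0 ⟨by linarith, le_rfl⟩ x) ?_ t ht x
  · simpa [hW] using this
  intro t ht x
  obtain ⟨ht', hx', hxx'⟩ := hasDerivAt_expWave A l c 0 γ t x
  refine ⟨W, _, _, _, deriv g 0 * W (t - h) x, fun _ _ => le_rfl, rfl, ht', hx', hxx', ?_, ?_⟩
  · simp only [hW]
    rw [expWave_delay]
    nlinarith [mul_le_mul_of_nonneg_right hrate (hWpos t x).le]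
  · intro K hK hdel
    have hd : |u (t - h) x - φ (x + c * (t - h))| ≤ W (t - h) x + K := by
      rcases le_or_gt h t with hht | hht
      · exact hdel hht
      · linarith [hstrip (t - h) ⟨by linarith, by linarith⟩ x]
    have hL := hg.hypH.lipschitz _ _ (hu.nonneg (t - h) (by linarith) x)
      (hφ.pos (x + c * (t - h))).le
    nlinarith [mul_le_mul_of_nonneg_left hd hp]

/-! ### Lipschitz estimates of the birth function near the equilibrium -/

theorem abs_sub_le_of_abs_deriv_lt_one {g : ℝ → ℝ} {κ ρ : ℝ}
    (hd : ∀ v ∈ Icc (κ - ρ) (κ + ρ), DifferentiableAt ℝ g v ∧ |deriv g v| < 1)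
    {a v : ℝ} (ha : a ∈ Icc (κ - ρ) (κ + ρ)) (hv : v ∈ Icc (κ - ρ) (κ + ρ)) :
    |g a - g v| ≤ |a - v| := by
  simpa using (convex_Icc (κ - ρ) (κ + ρ)).norm_image_sub_le_of_norm_deriv_le (C := 1)
    (fun x hx => (hd x hx).1) (fun x hx => (hd x hx).2.le) hv ha

/-- The derivative of `g` is not assumed continuous on `[κ - ρ, κ + ρ]`, so `g` need not be a
contraction there; it is a uniform contraction relative to base points `v` close to `κ`, where `g`
is `C¹`: the part of the segment from `v` to `a` near `κ` makes up a fixed fraction of it. -/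
theorem exists_contraction_near_kappa {g : ℝ → ℝ} {κ ρ δ : ℝ} (hρ : 0 < ρ) (hδ : 0 < δ)
    (hsm : ContDiffOn ℝ 1 g (Metric.ball κ δ))
    (hd : ∀ v ∈ Icc (κ - ρ) (κ + ρ), DifferentiableAt ℝ g v ∧ |deriv g v| < 1) :
    ∃ ℓ, 0 ≤ ℓ ∧ ℓ < 1 ∧ ∃ η > 0, ∀ v ∈ Icc (κ - η) (κ + η), ∀ a ∈ Icc (κ - ρ) (κ + ρ),
      |g a - g v| ≤ ℓ * |a - v| := by
  have hκ1 := (hd κ ⟨by linarith, by linarith⟩).2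
  have hcd : ContinuousAt (deriv g) κ :=
    (hsm.continuousOn_deriv_of_isOpen Metric.isOpen_ball le_rfl).continuousAt
      (Metric.ball_mem_nhds κ hδ)
  obtain ⟨ℓ₁, hℓ₁, hℓ₁'⟩ := exists_between hκ1
  have hℓ₁0 : 0 ≤ ℓ₁ := (abs_nonneg _).trans hℓ₁.le
  obtain ⟨r₀, hr₀, hball⟩ := Metric.eventually_nhds_iff_ball.1 (hcd.abs.eventually_lt_const hℓ₁)
  set r := min (r₀ / 2) ρ with hr
  have hr0 : 0 < r := by positivity
  have hrρ : r ≤ ρ := min_le_right _ _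
  have hlip : ∀ a ∈ Icc (κ - r) (κ + r), ∀ v ∈ Icc (κ - r) (κ + r),
      |g a - g v| ≤ ℓ₁ * |a - v| := by
    intro a ha v hv
    refine (convex_Icc (κ - r) (κ + r)).norm_image_sub_le_of_norm_deriv_le
      (fun x hx => (hd x ⟨by linarith [hx.1], by linarith [hx.2]⟩).1) (fun x hx => ?_) hv ha
    refine (hball x ?_).le
    have : r < r₀ := (min_le_left _ _).trans_lt (by linarith)
    rw [Metric.mem_ball, Real.dist_eq, abs_lt]
    constructor <;> linarith [hx.1, hx.2]
  have hq : r / (4 * ρ) ≤ 1 := by rw [div_le_one (by positivity)]; linarith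
  have hq0 : 0 < r / (4 * ρ) := by positivity
  set q := r / (4 * ρ) with hqdef
  have hqρ : q * (2 * ρ) = r / 2 := by rw [hqdef]; field_simp; norm_num
  refine ⟨1 - (1 - ℓ₁) * q, by nlinarith, by nlinarith, r / 2, by positivity, ?_⟩
  intro v hv a ha
  have hv' : v ∈ Icc (κ - r) (κ + r) := ⟨by linarith [hv.1], by linarith [hv.2]⟩
  have hL := @abs_sub_le_of_abs_deriv_lt_one g κ ρ hd
  rcases lt_or_ge (κ + r) a with h1 | h1
  · have hm : κ + r ∈ Icc (κ - r) (κ + r) := ⟨by linarith, le_rfl⟩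
    have e1 := hL ha ⟨by linarith, by linarith⟩ (v := κ + r)
    have e2 := hlip _ hm v hv'
    have e3 := abs_sub_le (g a) (g (κ + r)) (g v)
    rw [abs_of_pos (by linarith : 0 < a - (κ + r))] at e1
    rw [abs_of_pos (by linarith [hv.2] : 0 < κ + r - v)] at e2
    rw [abs_of_pos (by linarith [hv.2] : 0 < a - v)]
    have e4 : q * (a - v) ≤ κ + r - v := by
      have : q * (a - v) ≤ q * (2 * ρ) := by gcongr; linarith [ha.2, hv'.1]
      linarith [hv.2]
    nlinarith
  rcases lt_or_ge a (κ - r) with h2 | h2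
  · have hm : κ - r ∈ Icc (κ - r) (κ + r) := ⟨le_rfl, by linarith⟩
    have e1 := hL ha ⟨by linarith, by linarith⟩ (v := κ - r)
    have e2 := hlip _ hm v hv'
    have e3 := abs_sub_le (g a) (g (κ - r)) (g v)
    rw [abs_of_neg (by linarith : a - (κ - r) < 0)] at e1
    rw [abs_of_neg (by linarith [hv.1] : κ - r - v < 0)] at e2
    rw [abs_of_neg (by linarith [hv.1] : a - v < 0)]
    have e4 : q * (v - a) ≤ v - (κ - r) := by
      have : q * (v - a) ≤ q * (2 * ρ) := by gcongr; linarith [ha.1, hv'.2]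
      linarith [hv.1]
    nlinarith
  · have e2 := hlip a ⟨h2, h1⟩ v hv'
    refine e2.trans (mul_le_mul_of_nonneg_right ?_ (abs_nonneg _))
    nlinarith

/-- A local Lipschitz bound with constant `a` on the interval of radius `D` about `v`, continued by
the global constant `p` beyond it. -/
theorem abs_sub_le_of_local_lipschitz {g : ℝ → ℝ} {p a D K v w : ℝ} (hp : 0 ≤ p) (ha : 0 ≤ a)
    (hD : 0 ≤ D) (hK : 0 ≤ K)
    (hLip : ∀ x y, 0 ≤ x → 0 ≤ y → |g x - g y| ≤ p * |x - y|)
    (hloc : ∀ x, |x - v| ≤ D → |g x - g v| ≤ a * |x - v|) (hv : 0 ≤ v) (hw : 0 ≤ w)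
    (hwv : |w - v| ≤ D + K) : |g w - g v| ≤ a * D + p * K := by
  have hpK := mul_nonneg hp hK
  rcases le_or_gt |w - v| D with h | h
  · linarith [hloc w h, mul_le_mul_of_nonneg_left h ha]
  obtain ⟨x, hx0, hxv, hxw⟩ : ∃ x, 0 ≤ x ∧ |x - v| = D ∧ |w - x| ≤ K := by
    rcases abs_cases (w - v) with ⟨h1, h2⟩ | ⟨h1, h2⟩
    · refine ⟨v + D, by linarith, by rw [add_sub_cancel_left, abs_of_nonneg hD], ?_⟩
      rw [abs_of_pos (by linarith)]; linarith
    · refine ⟨v - D, by linarith, by rw [sub_sub_cancel_left, abs_neg, abs_of_nonneg hD], ?_⟩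
      rw [abs_of_neg (by linarith)]; linarith
  have e1 := hLip w x hw hx0
  have e2 := hloc x hxv.le
  rw [hxv] at e2
  linarith [abs_sub_le (g w) (g x) (g v), mul_le_mul_of_nonneg_left hxw hp]

/-! ### Convergence of the profile to the equilibrium -/

/-- Bounded solutions of `y'' - c y' - y + f = 0` on a half-line are driven below any bound of `f`
exponentially fast. -/
theorem le_add_exp_of_ode {y y' y'' f : ℝ → ℝ} {c Z F B : ℝ} (hc : 0 ≤ c)
    (hy : ∀ z, HasDerivAt y (y' z) z) (hy' : ∀ z, HasDerivAt y' (y'' z) z)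
    (hB : 0 ≤ B) (hF : 0 ≤ F) (hyB : ∀ z, Z ≤ z → y z ≤ B)
    (heq : ∀ z, Z ≤ z → y'' z - c * y' z - y z + f z = 0) (hf : ∀ z, Z ≤ z → f z ≤ F) :
    ∀ z, Z ≤ z → y z ≤ F + B * Real.exp (-((c + 1)⁻¹ * (z - Z))) := by
  set μ := (c + 1)⁻¹ with hμ
  have hμ0 : 0 < μ := by positivity
  have hμ1 : μ ^ 2 + c * μ ≤ 1 := by
    have h1 : μ ≤ 1 := inv_le_one_of_one_le₀ (by linarith)
    have h2 : (c + 1) * μ = 1 := mul_inv_cancel₀ (by positivity)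
    nlinarith
  intro z₀ hz₀
  refine le_of_forall_pos_le_add fun ε' hε' => ?_
  by_contra! hcon
  -- The barrier `ε e^{z - Z}` is unbounded and adds `ε'` at `z₀`.
  set ε := ε' * Real.exp (-(z₀ - Z)) with hε
  have hε0 : 0 < ε := by positivity
  set v : ℝ → ℝ := fun z =>
    y z - (F + B * Real.exp (-(μ * (z - Z))) + ε * Real.exp (z - Z)) with hv
  have hv0 : 0 < v z₀ := by
    simp only [hv, hε]
    rw [mul_assoc, ← Real.exp_add, neg_add_cancel, Real.exp_zero]
    linarith
  have hv1 : ∀ z, HasDerivAt v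
      (y' z - (-μ * B * Real.exp (-(μ * (z - Z))) + ε * Real.exp (z - Z))) z := fun z => by
    have e1 : HasDerivAt (fun z => -(μ * (z - Z))) (-μ) z :=
      ((((hasDerivAt_id z).sub_const Z).const_mul μ).neg).congr_deriv (by simp)
    have e2 : HasDerivAt (fun z => z - Z) 1 z := (hasDerivAt_id z).sub_const Z
    exact ((hy z).sub (((e1.exp.const_mul B).const_add F).add (e2.exp.const_mul ε))).congr_deriv
      (by ring)
  have hv2 : ∀ z, HasDerivAt
      (fun z => y' z - (-μ * B * Real.exp (-(μ * (z - Z))) + ε * Real.exp (z - Z)))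
      (y'' z - (μ ^ 2 * B * Real.exp (-(μ * (z - Z))) + ε * Real.exp (z - Z))) z := fun z => by
    have e1 : HasDerivAt (fun z => -(μ * (z - Z))) (-μ) z :=
      ((((hasDerivAt_id z).sub_const Z).const_mul μ).neg).congr_deriv (by simp)
    have e2 : HasDerivAt (fun z => z - Z) 1 z := (hasDerivAt_id z).sub_const Z
    exact ((hy' z).sub ((e1.exp.const_mul (-μ * B)).add (e2.exp.const_mul ε))).congr_deriv
      (by ring)
  set Z₁ := max z₀ (Z + B / ε) with hZ₁
  have hZZ₁ : Z ≤ Z₁ := hz₀.trans (le_max_left _ _)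
  obtain ⟨ζ, hζ, hmax⟩ := isCompact_Icc.exists_isMaxOn (nonempty_Icc.2 hZZ₁)
    (fun z _ => (hv1 z).continuousAt.continuousWithinAt : ContinuousOn v (Icc Z Z₁))
  have hvζ : 0 < v ζ := hv0.trans_le (hmax ⟨hz₀, le_max_left _ _⟩)
  have hζZ : Z < ζ := by
    rcases hζ.1.eq_or_lt with h | h
    · exfalso
      rw [← h] at hvζ
      simp only [hv, sub_self, mul_zero, neg_zero, Real.exp_zero, mul_one] at hvζ
      linarith [hyB Z le_rfl]
    · exact h
  have hζZ₁ : ζ < Z₁ := by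
    rcases hζ.2.eq_or_lt with h | h
    · exfalso
      have h1 : B / ε ≤ Real.exp (ζ - Z) := by
        have := Real.add_one_le_exp (ζ - Z)
        have := le_max_right z₀ (Z + B / ε)
        linarith
      rw [div_le_iff₀ hε0] at h1
      have h2 : 0 ≤ B * Real.exp (-(μ * (ζ - Z))) := by positivity
      simp only [hv] at hvζ
      linarith [hyB ζ hζ.1]
    · exact h
  have hloc : IsLocalMax v ζ := hmax.isLocalMax (Icc_mem_nhds hζZ hζZ₁)
  have hd1 := hloc.hasDerivAt_eq_zero (hv1 ζ)
  have hd2 := second_deriv_nonpos_of_isLocalMax hv1 (hv2 ζ) hloc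
  have h1 : 0 ≤ B * Real.exp (-(μ * (ζ - Z))) := by positivity
  have h2 : 0 ≤ ε * Real.exp (ζ - Z) := by positivity
  have h3 := heq ζ hζ.1
  have h4 := hf ζ hζ.1
  simp only [hv] at hvζ
  nlinarith [mul_nonneg hc h2, mul_le_mul_of_nonneg_right hμ1 h1]

/-- If `φ` eventually stays in a neighbourhood of `κ` in which `g` contracts towards `κ`, then each
passage through the equation shrinks the eventual distance of `φ` to `κ` by a fixed factor. -/
theorem tendsto_kappa_of_contraction {g φ : ℝ → ℝ} {h c κ ℓ R Z : ℝ} (hc : 0 ≤ c)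
    (hφ : IsWaveProfile g h c φ) (hR : 0 < R) (hℓ0 : 0 ≤ ℓ) (hℓ : ℓ < 1)
    (hg : ∀ a ∈ Icc (κ - R) (κ + R), |g a - κ| ≤ ℓ * |a - κ|)
    (hφR : ∀ z, Z ≤ z → |φ z - κ| ≤ R) : Tendsto φ atTop (𝓝 κ) := by
  have hφ1 : ∀ z, HasDerivAt φ (deriv φ z) z := fun z =>
    (hφ.contDiff.differentiable (by norm_num) z).hasDerivAt
  have hφ2 : ∀ z, HasDerivAt (deriv φ) (deriv (deriv φ) z) z := fun z =>
    ((contDiff_succ_iff_deriv (n := 1).1 hφ.contDiff).2.2.differentiable (by norm_num) z).hasDerivAt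
  have key : ∀ n : ℕ, ∃ Z, ∀ z, Z ≤ z → |φ z - κ| ≤ ((1 + ℓ) / 2) ^ n * R := by
    intro n
    induction n with
    | zero => exact ⟨Z, by simpa using hφR⟩
    | succ n ih =>
      obtain ⟨Z₀, hZ₀⟩ := ih
      set r := ((1 + ℓ) / 2) ^ n * R with hr
      have hr0 : 0 < r := by positivity
      have hrR : r ≤ R := mul_le_of_le_one_left hR.le (pow_le_one₀ (by linarith) (by linarith))
      set Z₁ := max Z₀ (Z₀ + c * h) with hZ₁
      have hreac : ∀ z, Z₁ ≤ z → |g (φ (z - c * h)) - κ| ≤ ℓ * r := by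
        intro z hz
        have h1 := hZ₀ (z - c * h) (by linarith [le_max_right Z₀ (Z₀ + c * h)])
        have h2 := abs_le.1 h1
        exact (hg _ ⟨by linarith [h2.1], by linarith [h2.2]⟩).trans
          (mul_le_mul_of_nonneg_left h1 hℓ0)
      have hbd : ∀ z, Z₁ ≤ z → |φ z - κ| ≤ r := fun z hz =>
        hZ₀ z ((le_max_left _ _).trans hz)
      have hup := le_add_exp_of_ode (y := fun z => φ z - κ) (f := fun z => g (φ (z - c * h)) - κ)
        (Z := Z₁) (F := ℓ * r) (B := r) hc (fun z => (hφ1 z).sub_const κ) hφ2 hr0.le (by positivity)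
        (fun z hz => (abs_le.1 (hbd z hz)).2) (fun z _ => by linarith [hφ.equation z])
        (fun z hz => (abs_le.1 (hreac z hz)).2)
      have hlow := le_add_exp_of_ode (y := fun z => -(φ z - κ))
        (f := fun z => -(g (φ (z - c * h)) - κ))
        (Z := Z₁) (F := ℓ * r) (B := r) hc (fun z => ((hφ1 z).sub_const κ).neg)
        (fun z => (hφ2 z).neg) hr0.le (by positivity)
        (fun z hz => by linarith [(abs_le.1 (hbd z hz)).1])
        (fun z _ => by linarith [hφ.equation z])
        (fun z hz => by linarith [(abs_le.1 (hreac z hz)).1])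
      have hlim : Tendsto (fun z => ℓ * r + r * Real.exp (-((c + 1)⁻¹ * (z - Z₁)))) atTop
          (𝓝 (ℓ * r)) := by
        have e : Tendsto (fun z => (c + 1)⁻¹ * (z - Z₁)) atTop atTop :=
          (tendsto_atTop_add_const_right _ (-Z₁) tendsto_id).const_mul_atTop (by positivity)
        simpa using ((Real.tendsto_exp_neg_atTop_nhds_zero.comp e).const_mul r).const_add (ℓ * r)
      have hlt : ℓ * r < ((1 + ℓ) / 2) ^ (n + 1) * R := by
        rw [pow_succ, mul_right_comm, ← hr]
        nlinarith
      obtain ⟨Z₂, hZ₂⟩ := eventually_atTop.1 (hlim.eventually_le_const hlt)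
      refine ⟨max Z₁ Z₂, fun z hz => ?_⟩
      have h1 := (le_max_left _ _).trans hz
      have h2 := hZ₂ z ((le_max_right _ _).trans hz)
      have h3 := hup z h1
      have h4 := hlow z h1
      exact abs_le.2 ⟨by linarith, by linarith⟩
  have hpow : Tendsto (fun n : ℕ => ((1 + ℓ) / 2) ^ n * R) atTop (𝓝 0) := by
    simpa using (tendsto_pow_atTop_nhds_zero_of_lt_one (by linarith : 0 ≤ (1 + ℓ) / 2)
      (by linarith)).mul_const R
  rw [Metric.tendsto_atTop]
  intro ε hε
  obtain ⟨n, hn⟩ := (hpow.eventually_lt_const hε).exists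
  obtain ⟨Z, hZ⟩ := key n
  exact ⟨Z, fun z hz => by rw [Real.dist_eq]; exact (hZ z hz).trans_lt hn⟩

/-! ### Stability in the bounded weight -/

/-- A strict bound on `[a, ∞)`, uniform near infinity, holds with a gap on a slightly larger
half-line. -/
theorem exists_uniform_gap {f : ℝ → ℝ → ℝ} {h a X r r₁ : ℝ} (hh : 0 ≤ h)
    (hf : ContinuousOn (fun q : ℝ × ℝ => f q.1 q.2) (Icc (-h) 0 ×ˢ univ))
    (hlt : ∀ s ∈ Icc (-h) 0, ∀ x, a ≤ x → f s x < r) (hr₁ : r₁ < r)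
    (hX : ∀ s ∈ Icc (-h) 0, ∀ x, X ≤ x → f s x ≤ r₁) :
    ∃ ε > 0, ∃ r₂ < r, ∀ s ∈ Icc (-h) 0, ∀ x, a - ε ≤ x → f s x ≤ r₂ := by
  have hK : IsCompact (Icc (-h) 0 ×ˢ Icc a (max a X)) := isCompact_Icc.prod isCompact_Icc
  obtain ⟨⟨s₀, x₀⟩, ⟨hs₀, hx₀⟩, hmax⟩ := hK.exists_isMaxOn
    ⟨((0 : ℝ), a), ⟨by linarith, le_rfl⟩, le_rfl, le_max_left _ _⟩
    (hf.mono (prod_mono le_rfl (subset_univ _)))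
  have hr₃ : f s₀ x₀ < r := hlt s₀ hs₀ x₀ hx₀.1
  have hK' : IsCompact (Icc (-h) 0 ×ˢ Icc (a - 1) a) := isCompact_Icc.prod isCompact_Icc
  have huc := hK'.uniformContinuousOn_of_continuous (hf.mono (prod_mono le_rfl (subset_univ _)))
  obtain ⟨η, hη, hηf⟩ := Metric.uniformContinuousOn_iff.1 huc ((r - f s₀ x₀) / 2) (by linarith)
  refine ⟨min (η / 2) 1, by positivity, max r₁ ((r + f s₀ x₀) / 2), max_lt hr₁ (by linarith), ?_⟩
  intro s hs x hx
  rcases le_or_gt X x with h1 | h1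
  · exact (hX s hs x h1).trans (le_max_left _ _)
  rcases le_or_gt a x with h2 | h2
  · have := hmax (show (s, x) ∈ Icc (-h) 0 ×ˢ Icc a (max a X) from
      ⟨hs, h2, h1.le.trans (le_max_right _ _)⟩)
    simp only [mem_ofPred_eq] at this
    exact le_max_of_le_right (by linarith)
  · have hm1 := min_le_left (η / 2) 1
    have hm2 := min_le_right (η / 2) 1
    have hd := hηf (s, x) ⟨hs, by linarith, h2.le⟩ (s, a) ⟨hs, by linarith, le_rfl⟩ (by
      rw [Prod.dist_eq, dist_self, Real.dist_eq, max_eq_right (abs_nonneg _), abs_of_neg (by linarith)]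
      linarith)
    have ha := hmax (show (s, a) ∈ Icc (-h) 0 ×ˢ Icc a (max a X) from
      ⟨hs, le_rfl, le_max_left _ _⟩)
    simp only [mem_ofPred_eq] at ha
    rw [Real.dist_eq] at hd
    exact le_max_of_le_right (by linarith [(abs_lt.1 hd).2])

/-- The plateau `θ(z) = 1 - δ + (δ / 2) arctan (z - m)`: strictly increasing, concave on `[m, ∞)`,
with values in `[1 - 2 δ, 1]`. -/
noncomputable def plateau (δ m z : ℝ) : ℝ := 1 - δ + δ / 2 * Real.arctan (z - m)

theorem plateau_le_one {δ : ℝ} (hδ : 0 < δ) (m z : ℝ) : plateau δ m z ≤ 1 := by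
  have := Real.arctan_lt_pi_div_two (z - m)
  have := Real.pi_le_four
  unfold plateau; nlinarith

theorem le_plateau {δ : ℝ} (hδ : 0 < δ) (m z : ℝ) : 1 - 2 * δ ≤ plateau δ m z := by
  have := Real.neg_pi_div_two_lt_arctan (z - m)
  have := Real.pi_le_four
  unfold plateau; nlinarith

theorem le_plateau_of_le {δ m z : ℝ} (hδ : 0 < δ) (hz : m ≤ z) : 1 - δ ≤ plateau δ m z := by
  have : 0 ≤ Real.arctan (z - m) := by
    rw [← Real.arctan_zero]; exact Real.arctan_mono (by linarith)
  unfold plateau; nlinarith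

theorem plateau_mono {δ : ℝ} (hδ : 0 < δ) (m : ℝ) : Monotone (plateau δ m) := fun x y hxy => by
  unfold plateau
  have : Real.arctan (x - m) ≤ Real.arctan (y - m) := Real.arctan_mono (by linarith)
  gcongr

/-- Derivatives of the supersolution `A e^{-γ t} θ(x + c t)`. -/
theorem hasDerivAt_plateauWave (A δ m c γ t x : ℝ) :
    HasDerivAt (fun s => A * Real.exp (-(γ * s)) * plateau δ m (x + c * s))
      (A * Real.exp (-(γ * t)) *
        (c * (δ / 2 / (1 + (x + c * t - m) ^ 2)) - γ * plateau δ m (x + c * t))) t ∧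
    (∀ x', HasDerivAt (fun x' => A * Real.exp (-(γ * t)) * plateau δ m (x' + c * t))
      (A * Real.exp (-(γ * t)) * (δ / 2 / (1 + (x' + c * t - m) ^ 2))) x') ∧
    HasDerivAt (fun x' => A * Real.exp (-(γ * t)) * (δ / 2 / (1 + (x' + c * t - m) ^ 2)))
      (A * Real.exp (-(γ * t)) *
        (-(δ * (x + c * t - m)) / (1 + (x + c * t - m) ^ 2) ^ 2)) x := by
  have hz : ∀ x', HasDerivAt (fun x' => x' + c * t - m) 1 x' := fun x' =>
    ((hasDerivAt_id x').add_const (c * t)).sub_const m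
  refine ⟨?_, fun x' => ?_, ?_⟩
  · have e1 : HasDerivAt (fun s => -(γ * s)) (-γ) t :=
      (((hasDerivAt_id t).const_mul γ).neg).congr_deriv (by simp)
    have e2 : HasDerivAt (fun s => x + c * s - m) c t :=
      ((((hasDerivAt_id t).const_mul c).const_add x).sub_const m).congr_deriv (by simp)
    refine ((e1.exp.const_mul A).mul
      ((e2.arctan.const_mul (δ / 2)).const_add (1 - δ))).congr_deriv ?_
    simp only [plateau]; ring
  · refine ((((hz x').arctan.const_mul (δ / 2)).const_add (1 - δ)).const_mul
      (A * Real.exp (-(γ * t)))).congr_deriv ?_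
    ring
  · have h0 : 1 + (x + c * t - m) ^ 2 ≠ 0 := by positivity
    refine (((((hz x).pow 2).const_add 1).inv h0).const_mul
      (A * Real.exp (-(γ * t)) * (δ / 2))).congr_deriv ?_ |>.congr_of_eventuallyEq
        (Eventually.of_forall fun x' => ?_)
    · simp only [Pi.pow_apply]
      field_simp
      push_cast
      ring
    · simp only [Pi.inv_apply, Pi.pow_apply]
      ring

/-- The supersolution `A e^{-γ t} min (e^{l (z - b)}, θ(z))` with `z = x + c t`. On the exponential
branch, which is active only for `z ≤ b`, the global Lipschitz constant `p` suffices. On the plateau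
branch, active only for `z ≥ b - ε`, `g` is nonexpanding relative to `φ`; there the decay comes from
the growth of `θ` for `z ≤ Z`, and from the contraction constant `ℓ < 1` for `z ≥ Z`. -/
theorem abs_sub_wave_le_min {h c p l b ρ δ ε γ ℓ Z m : ℝ} {g φ : ℝ → ℝ} {w₀ u : ℝ → ℝ → ℝ}
    (hh : 0 ≤ h) (hp : 0 ≤ p) (hc : 0 < c) (hl : 0 < l) (hρ : 0 < ρ) (hδ : 0 < δ) (hε : 0 < ε)
    (hγ : 0 < γ) (hℓ : 0 ≤ ℓ) (hm : m = b - c * h - ε)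
    (hLip : ∀ x y, 0 ≤ x → 0 ≤ y → |g x - g y| ≤ p * |x - y|)
    (hu : IsClassicalSolution h g w₀ u) (hφ : IsWaveProfile g h c φ)
    (hrate₁ : p * Real.exp (-(l * c * h)) * Real.exp (γ * h) ≤ l * c - γ - l ^ 2 + 1)
    (hrate₂ : γ + Real.exp (γ * h) - 1 ≤ c * (δ / 2 / (1 + (Z - m) ^ 2)))
    (hrate₃ : ℓ * Real.exp (γ * h) ≤ 1 - γ)
    (hδε : Real.exp (-(l * ε)) ≤ 1 - 2 * δ)
    (hloc₁ : ∀ z, m ≤ z → ∀ v, |v - φ z| ≤ ρ / 2 → |g v - g (φ z)| ≤ |v - φ z|)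
    (hloc₂ : ∀ z, m ≤ z → Z - c * h ≤ z → ∀ v, |v - φ z| ≤ ρ / 2 →
      |g v - g (φ z)| ≤ ℓ * |v - φ z|)
    (hinit₁ : ∀ s ∈ Icc (-h) 0, ∀ x, x ≤ b →
      |u s x - φ (x + c * s)| ≤ ρ / 2 * Real.exp (l * (x + c * s - b)))
    (hinit₂ : ∀ s ∈ Icc (-h) 0, ∀ x, m ≤ x → |u s x - φ (x + c * s)| ≤ (1 - δ) * (ρ / 2)) :
    ∀ t, 0 ≤ t → ∀ x, |u t x - φ (x + c * t)| ≤
      ρ / 2 * Real.exp (-(γ * t)) * min (Real.exp (l * (x + c * t - b)))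
        (plateau δ m (x + c * t)) := by
  have hδ2 : 0 < 1 - 2 * δ := (Real.exp_pos _).trans_le hδε
  have hθpos : ∀ z, 0 < plateau δ m z := fun z => hδ2.trans_le (le_plateau hδ m z)
  have hch : 0 ≤ c * h := by positivity
  -- Where the plateau branch is active, `z ≥ b - ε`.
  have hactive : ∀ z, plateau δ m z < Real.exp (l * (z - b)) → b - ε ≤ z := by
    intro z hz
    by_contra! hcon
    have : Real.exp (l * (z - b)) ≤ Real.exp (-(l * ε)) := Real.exp_le_exp.2 (by nlinarith)
    linarith [le_plateau hδ m z]
  refine abs_sub_wave_le_of_supersolution (W := fun t x => ρ / 2 * Real.exp (-(γ * t)) *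
    min (Real.exp (l * (x + c * t - b))) (plateau δ m (x + c * t))) hh hp hu hφ ?_ ?_ ?_ ?_
  · unfold plateau; fun_prop
  · intro t x
    have := (hθpos (x + c * t)).le
    positivity
  · intro x
    simp only [mul_zero, neg_zero, Real.exp_zero, mul_one, add_zero]
    have h0 : (0 : ℝ) ∈ Icc (-h) 0 := ⟨by linarith, le_rfl⟩
    have h1 := hinit₁ 0 h0 x
    have h2 := hinit₂ 0 h0 x
    simp only [mul_zero, add_zero] at h1 h2
    rw [mul_min_of_nonneg _ _ (by positivity : 0 ≤ ρ / 2)]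
    refine le_min ?_ ?_
    · rcases le_or_gt x b with hx | hx
      · exact h1 hx
      · have e1 : (1 : ℝ) ≤ Real.exp (l * (x - b)) := Real.one_le_exp (by nlinarith)
        have := h2 (by linarith)
        nlinarith
    · rcases le_or_gt m x with hx | hx
      · have := h2 hx
        nlinarith [le_plateau_of_le hδ hx]
      · have e1 : Real.exp (l * (x - b)) ≤ Real.exp (-(l * ε)) := Real.exp_le_exp.2 (by nlinarith)
        have := h1 (by linarith)
        nlinarith [le_plateau hδ m x]
  intro t ht x
  set A := ρ / 2 * Real.exp (-(γ * t)) with hA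
  have hA0 : 0 < A := by positivity
  have hAd : ρ / 2 * Real.exp (-(γ * (t - h))) = A * Real.exp (γ * h) := by
    rw [hA, mul_assoc, ← Real.exp_add]; ring_nf
  have hut0 := hu.nonneg (t - h) (by linarith) x
  have hφ0 := (hφ.pos (x + c * (t - h))).le
  set w := |u (t - h) x - φ (x + c * (t - h))| with hw
  rcases le_or_gt (Real.exp (l * (x + c * t - b))) (plateau δ m (x + c * t)) with hcase | hcase
  · -- The exponential branch: the delayed bound is used with the constant `p`, and for `t < h` the
    -- point `(t - h, x)` of the initial strip has `x ≤ b`.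
    have hzb : x + c * t ≤ b := by
      by_contra! hcon
      have : 1 < Real.exp (l * (x + c * t - b)) := Real.one_lt_exp_iff.2 (by nlinarith)
      linarith [plateau_le_one hδ m (x + c * t)]
    obtain ⟨hVt, hVx, hVxx⟩ := hasDerivAt_expWave (ρ / 2) l c b γ t x
    refine ⟨fun s x' => ρ / 2 * Real.exp (-(γ * s)) * Real.exp (l * (x' + c * s - b)), _, _, _,
      p * (ρ / 2 * Real.exp (-(γ * (t - h))) * Real.exp (l * (x + c * (t - h) - b))),
      ?_, ?_, hVt, hVx, hVxx, ?_, ?_⟩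
    · intro s x'
      exact mul_le_mul_of_nonneg_left (min_le_left _ _) (by positivity)
    · simp only [min_eq_left hcase, hA]
    · rw [expWave_delay, min_eq_left hcase, ← hA]
      have : 0 ≤ A * Real.exp (l * (x + c * t - b)) := by positivity
      linarith [mul_le_mul_of_nonneg_right hrate₁ this]
    · intro K hK hdel
      have hd : w ≤ ρ / 2 * Real.exp (-(γ * (t - h))) * Real.exp (l * (x + c * (t - h) - b)) + K := by
        rcases le_or_gt h t with hht | hht
        · refine (hdel hht).trans ?_
          gcongr
          exact min_le_left _ _
        · have e1 := hinit₁ (t - h) ⟨by linarith, by linarith⟩ x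
            (by linarith [mul_pos hc ht])
          have e2 : (1 : ℝ) ≤ Real.exp (-(γ * (t - h))) :=
            Real.one_le_exp (by linarith [mul_pos hγ (sub_pos.2 hht)])
          have e3 : 0 ≤ ρ / 2 * Real.exp (l * (x + c * (t - h) - b)) := by positivity
          linarith [mul_le_mul_of_nonneg_left e2 e3]
      have hL := hLip _ _ hut0 hφ0
      linarith [mul_le_mul_of_nonneg_left hd hp]
  · -- The plateau branch: `θ(z - c h) ≤ θ(z)`, and for `t < h` the point `(t - h, x)` of the initial
    -- strip has `x ≥ m`, where the initial difference is at most `(1 - δ) ρ / 2`.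
    have hz := hactive _ hcase
    have hmd : m ≤ x + c * (t - h) := by rw [hm]; linarith
    have hmz : m ≤ x + c * t := by linarith
    obtain ⟨hVt, hVx, hVxx⟩ := hasDerivAt_plateauWave (ρ / 2) δ m c γ t x
    have hθ1 := plateau_le_one hδ m (x + c * t)
    have hθmono : plateau δ m (x + c * (t - h)) ≤ plateau δ m (x + c * t) :=
      plateau_mono hδ m (by linarith)
    have hθ0 := hθpos (x + c * (t - h))
    obtain ⟨a, ha0, haloc, harate⟩ : ∃ a : ℝ, 0 ≤ a ∧
        (∀ v, |v - φ (x + c * (t - h))| ≤ ρ / 2 → |g v - g (φ (x + c * (t - h)))| ≤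
          a * |v - φ (x + c * (t - h))|) ∧
        a * (Real.exp (γ * h) * plateau δ m (x + c * (t - h))) ≤
          c * (δ / 2 / (1 + (x + c * t - m) ^ 2)) + (1 - γ) * plateau δ m (x + c * t) := by
      have hE : 1 ≤ Real.exp (γ * h) := Real.one_le_exp (by positivity)
      rcases le_or_gt Z (x + c * t) with hZ | hZ
      · refine ⟨ℓ, hℓ, hloc₂ _ hmd (by linarith), ?_⟩
        have e1 : 0 ≤ c * (δ / 2 / (1 + (x + c * t - m) ^ 2)) := by positivity
        have e2 : ℓ * Real.exp (γ * h) * plateau δ m (x + c * (t - h)) ≤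
            ℓ * Real.exp (γ * h) * plateau δ m (x + c * t) := by gcongr
        linarith [mul_le_mul_of_nonneg_right hrate₃ (hθpos (x + c * t)).le]
      · refine ⟨1, zero_le_one, by simpa using hloc₁ _ hmd, ?_⟩
        have e1 : c * (δ / 2 / (1 + (Z - m) ^ 2)) ≤ c * (δ / 2 / (1 + (x + c * t - m) ^ 2)) := by
          gcongr
        have e2 : Real.exp (γ * h) * plateau δ m (x + c * (t - h)) ≤
            Real.exp (γ * h) * plateau δ m (x + c * t) := by gcongr
        have e3 : 0 ≤ (Real.exp (γ * h) + γ - 1) * (1 - plateau δ m (x + c * t)) :=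
          mul_nonneg (by linarith) (by linarith)
        linarith
    set D := ρ / 2 * Real.exp (-(γ * (t - h))) * plateau δ m (x + c * (t - h)) with hD
    have hD0 : 0 ≤ D := by positivity
    -- For `t < h` the factor `e^{-γ (t - h)}` is above `1`, and `D` may exceed the radius `ρ / 2` of
    -- the local bounds of `g`; the smaller `D'` does not, and still bounds the initial difference.
    have hcut : ∃ D', 0 ≤ D' ∧ D' ≤ D ∧ D' ≤ ρ / 2 ∧ (t < h → w ≤ D') ∧ (h ≤ t → D' = D) := by
      rcases le_or_gt h t with hht | hht
      · refine ⟨D, hD0, le_rfl, ?_, fun hcon => absurd hht hcon.not_ge, fun _ => rfl⟩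
        have e1 : Real.exp (-(γ * (t - h))) ≤ 1 := 
          Real.exp_le_one_iff.2 (by linarith [mul_nonneg hγ.le (sub_nonneg.2 hht)])
        have e2 := plateau_le_one hδ m (x + c * (t - h))
        calc D ≤ ρ / 2 * 1 * 1 := by rw [hD]; gcongr
          _ = ρ / 2 := by ring
      · have e1 : m ≤ x := by rw [hm]; linarith [mul_pos hc (sub_pos.2 hht)]
        have e2 := hinit₂ (t - h) ⟨by linarith, by linarith⟩ x e1
        refine ⟨(1 - δ) * (ρ / 2), mul_nonneg (by linarith) (by linarith), ?_,
          by linarith [mul_pos hδ hρ], fun _ => e2,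
          fun hcon => absurd hht hcon.not_gt⟩
        have e3 : (1 : ℝ) ≤ Real.exp (-(γ * (t - h))) :=
          Real.one_le_exp (by linarith [mul_pos hγ (sub_pos.2 hht)])
        calc (1 - δ) * (ρ / 2) = ρ / 2 * 1 * (1 - δ) := by ring
          _ ≤ D := by
            rw [hD]
            gcongr
            · linarith
            · exact le_plateau_of_le hδ hmd
    obtain ⟨D', hD'0, hD'D, hD'ρ, hD't, hD'eq⟩ := hcut
    refine ⟨fun s x' => ρ / 2 * Real.exp (-(γ * s)) * plateau δ m (x' + c * s), _, _, _, a * D,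
      ?_, ?_, hVt, hVx, hVxx, ?_, ?_⟩
    · intro s x'
      exact mul_le_mul_of_nonneg_left (min_le_right _ _) (by positivity)
    · simp only [min_eq_right hcase.le, hA]
    · rw [min_eq_right hcase.le, hD, hAd, ← hA]
      have e1 : 0 ≤ δ * (x + c * t - m) / (1 + (x + c * t - m) ^ 2) ^ 2 := by
        have : 0 ≤ x + c * t - m := by linarith
        positivity
      rw [neg_div]
      linarith [mul_le_mul_of_nonneg_left harate hA0.le, mul_nonneg hA0.le e1]
    · intro K hK hdel
      have hwD : w ≤ D' + K := by
        rcases le_or_gt h t with hht | hht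
        · rw [hD'eq hht]
          refine (hdel hht).trans ?_
          rw [hD]
          gcongr
          exact min_le_right _ _
        · linarith [hD't hht]
      have := abs_sub_le_of_local_lipschitz hp ha0 hD'0 hK hLip
        (fun v hv => haloc v (hv.trans hD'ρ)) hφ0 hut0 hwD
      linarith [mul_le_mul_of_nonneg_left hD'D ha0]

/-- Local stability in the weight `min (e^{l x}, 1)`: the hypotheses with strict inequalities supply
the constants `ε`, `δ`, `Z`, `ℓ`, `γ` of the supersolution in `abs_sub_wave_le_min`. -/
theorem wavefront_stability {h κ c l ρ b : ℝ} {g φ : ℝ → ℝ} {w₀ u : ℝ → ℝ → ℝ}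
    (hh : 0 ≤ h) (hg : HypUM g κ) (hw : IsInitialDatum h w₀) (hc : 0 < c) (hl : 0 < l)
    (hneg : charFun0 (deriv g 0) h c l < 0)
    (hφ : IsWaveProfile g h c φ) (hu : IsClassicalSolution h g w₀ u) (hρ : 0 < ρ)
    (hd : ∀ v ∈ Icc (κ - ρ) (κ + ρ), DifferentiableAt ℝ g v ∧ |deriv g v| < 1) (hb : 0 ≤ b)
    (hright : ∀ s ∈ Icc (-h) 0, ∀ x, b - c * h ≤ x →
      w₀ s x ∈ Ico (κ - ρ / 4) (κ + ρ / 4) ∧ φ (x + c * s) ∈ Ico (κ - ρ / 4) (κ + ρ / 4))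
    (hleft : ∀ s ∈ Icc (-h) 0, ∀ x, x ≤ b →
      |w₀ s x - φ (x + c * s)| ≤ ρ / 2 * Real.exp (l * (x + c * s - b))) :
    IsWavefront g h c κ φ ∧ ∃ γ > 0, ∀ t, 0 ≤ t → ∀ x,
      |u t x - φ (x + c * t)| / etaWeight l (x + c * t) ≤ ρ / 2 * Real.exp (-(γ * t)) := by
  have hp : 0 ≤ deriv g 0 := by linarith [hg.hypH.one_lt_deriv_zero]
  have hgκ : g κ = κ := (hg.hypH.fixed_iff κ hg.hypH.kappa_pos.le).2 (Or.inr rfl)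
  have hφc : Continuous φ := hφ.contDiff.continuous
  obtain ⟨r, hr, -, hsm, -⟩ := hg.hypH.smooth
  obtain ⟨ℓ, hℓ0, hℓ1, η, hη, hcontr⟩ := exists_contraction_near_kappa hρ hr hsm hd
  have h0 : (0 : ℝ) ∈ Icc (-h) 0 := ⟨by linarith, le_rfl⟩
  have hφb : ∀ z, b - c * h ≤ z → φ z ∈ Ico (κ - ρ / 4) (κ + ρ / 4) := fun z hz => by
    simpa using (hright 0 h0 z hz).2
  have hlim : Tendsto φ atTop (𝓝 κ) := by
    refine tendsto_kappa_of_contraction (R := ρ / 4) (Z := b - c * h) hc.le hφ (by linarith) hℓ0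
      hℓ1 (fun a ha => ?_) fun z hz => ?_
    · have := hcontr κ ⟨by linarith, by linarith⟩ a ⟨by linarith [ha.1], by linarith [ha.2]⟩
      rwa [hgκ] at this
    · have := hφb z hz
      exact abs_le.2 ⟨by linarith [this.1], by linarith [this.2]⟩
  refine ⟨{ hφ with tendsto_atTop := hlim }, ?_⟩
  -- Near infinity `φ` is close to `κ`, in the contraction sense and up to `ρ / 8`.
  obtain ⟨Z₀, hZ₀⟩ := eventually_atTop.1
    (hlim.eventually (Metric.ball_mem_nhds κ (lt_min hη (by positivity : 0 < ρ / 8))))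
  have hZ₀' : ∀ z, Z₀ ≤ z → |φ z - κ| < min η (ρ / 8) := fun z hz => by
    simpa [Real.dist_eq] using hZ₀ z hz
  -- The initial difference is below `ρ / 2` with a gap, also slightly to the left of `b - c h`.
  obtain ⟨ε₁, hε₁, r₂, hr₂, hgap⟩ := exists_uniform_gap
    (f := fun s x => |w₀ s x - φ (x + c * s)|) (a := b - c * h) (r := ρ / 2) (r₁ := 3 * ρ / 8)
    (X := max (b - c * h) (Z₀ + c * h)) hh
    (hw.continuousOn.sub (by fun_prop)).abs
    (fun s hs x hx => by
      obtain ⟨⟨h1, h2⟩, h3, h4⟩ := hright s hs x hx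
      exact abs_lt.2 ⟨by linarith, by linarith⟩) (by linarith)
    (fun s hs x hx => by
      obtain ⟨⟨h1, h2⟩, -⟩ := hright s hs x ((le_max_left _ _).trans hx)
      have h3 := (hZ₀' (x + c * s) (by
        nlinarith [(le_max_right _ _).trans hx, hs.1])).trans_le (min_le_right _ _)
      have h4 := abs_lt.1 h3
      exact abs_le.2 ⟨by linarith, by linarith⟩)
  obtain ⟨ε₂, hε₂, hφε⟩ : ∃ ε > 0, ∀ z, b - c * h - ε ≤ z →
      φ z ∈ Icc (κ - ρ / 2) (κ + ρ / 2) := by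
    have hev : ∀ᶠ z in 𝓝 (b - c * h), φ z ∈ Ioo (κ - ρ / 2) (κ + ρ / 2) := by
      have := hφb (b - c * h) le_rfl
      exact hφc.continuousAt.eventually
        (Ioo_mem_nhds (by linarith [this.1]) (by linarith [this.2]))
    obtain ⟨e, he, hball⟩ := Metric.eventually_nhds_iff_ball.1 hev
    refine ⟨e / 2, by positivity, fun z hz => ?_⟩
    rcases le_or_gt (b - c * h) z with h1 | h1
    · have := hφb z h1
      exact ⟨by linarith [this.1], by linarith [this.2]⟩
    · have := hball z (by
        rw [Metric.mem_ball, Real.dist_eq, abs_lt]; constructor <;> linarith)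
      exact ⟨this.1.le, this.2.le⟩
  set ε := min ε₁ ε₂ with hε
  have hε0 : 0 < ε := lt_min hε₁ hε₂
  have hεle₁ : ε ≤ ε₁ := min_le_left _ _
  have hεle₂ : ε ≤ ε₂ := min_le_right _ _
  have hexp : Real.exp (-(l * ε)) < 1 :=
    Real.exp_lt_one_iff.2 (by have := mul_pos hl hε0; linarith)
  set δ := min (1 - 2 * r₂ / ρ) ((1 - Real.exp (-(l * ε))) / 2) with hδ
  have hδ0 : 0 < δ := by
    refine lt_min ?_ (by linarith)
    rw [sub_pos, div_lt_one hρ]; linarith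
  have hδr : r₂ ≤ (1 - δ) * (ρ / 2) := by
    have : δ ≤ 1 - 2 * r₂ / ρ := min_le_left _ _
    have h2 : 2 * r₂ / ρ * ρ = 2 * r₂ := by field_simp
    nlinarith
  have hδε : Real.exp (-(l * ε)) ≤ 1 - 2 * δ := by
    have : δ ≤ (1 - Real.exp (-(l * ε))) / 2 := min_le_right _ _
    linarith
  set m := b - c * h - ε with hm
  set Z := Z₀ + c * h with hZ
  have hpos₂ : 0 < c * (δ / 2 / (1 + (Z - m) ^ 2)) := by positivity
  have hev₂ : ∀ᶠ γ in 𝓝[>] (0 : ℝ),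
      γ + Real.exp (γ * h) - 1 ≤ c * (δ / 2 / (1 + (Z - m) ^ 2)) := by
    have ht : Tendsto (fun γ : ℝ => γ + Real.exp (γ * h) - 1) (𝓝 0) (𝓝 0) := by
      have hcont : Continuous fun γ : ℝ => γ + Real.exp (γ * h) - 1 := by fun_prop
      simpa using hcont.tendsto 0
    exact (ht.mono_left nhdsWithin_le_nhds).eventually_le_const hpos₂
  have hev₃ : ∀ᶠ γ in 𝓝[>] (0 : ℝ), ℓ * Real.exp (γ * h) ≤ 1 - γ := by
    have ht : Tendsto (fun γ : ℝ => ℓ * Real.exp (γ * h) + γ) (𝓝 0) (𝓝 ℓ) := by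
      have hcont : Continuous fun γ : ℝ => ℓ * Real.exp (γ * h) + γ := by fun_prop
      simpa using hcont.tendsto 0
    filter_upwards [(ht.mono_left nhdsWithin_le_nhds).eventually_le_const hℓ1] with γ hγ
    linarith
  obtain ⟨γ, ⟨⟨hrate₁, hrate₂⟩, hrate₃⟩, hγ⟩ :=
    ((((eventually_supersolution_rate hneg).and hev₂).and hev₃).and self_mem_nhdsWithin).exists
  replace hγ : 0 < γ := hγ
  have hmem : ∀ z, m ≤ z → ∀ v, |v - φ z| ≤ ρ / 2 → v ∈ Icc (κ - ρ) (κ + ρ) := by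
    intro z hz v hv
    have h1 := hφε z (by linarith)
    have h2 := abs_le.1 hv
    exact ⟨by linarith [h1.1, h2.1], by linarith [h1.2, h2.2]⟩
  have hbound := abs_sub_wave_le_min (p := deriv g 0) (Z := Z) (ℓ := ℓ) hh hp hc hl hρ hδ0 hε0 hγ
    hℓ0 hm hg.hypH.lipschitz hu hφ hrate₁ hrate₂ hrate₃ hδε
    (fun z hz v hv => by
      have h1 := hφε z (by linarith)
      exact abs_sub_le_of_abs_deriv_lt_one hd (hmem z hz v hv)
        ⟨by linarith [h1.1], by linarith [h1.2]⟩)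
    (fun z hz hzZ v hv => by
      have h1 := abs_lt.1 ((hZ₀' z (by linarith)).trans_le (min_le_left _ _))
      exact hcontr _ ⟨by linarith, by linarith⟩ v (hmem z hz v hv))
    (fun s hs x hx => by rw [hu.initial s hs x]; exact hleft s hs x hx)
    (fun s hs x hx => by
      rw [hu.initial s hs x]
      exact (hgap s hs x (by linarith)).trans hδr)
  refine ⟨γ, hγ, fun t ht x => ?_⟩
  have hη0 : 0 < etaWeight l (x + c * t) := lt_min (Real.exp_pos _) one_pos
  rw [div_le_iff₀ hη0]
  refine (hbound t ht x).trans (mul_le_mul_of_nonneg_left ?_ (by positivity))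
  exact min_le_min (Real.exp_le_exp.2 (by nlinarith)) (plateau_le_one hδ0 m _)

theorem theorem1p5 (h κ c l : ℝ) (g φ : ℝ → ℝ) (w₀ u : ℝ → ℝ → ℝ)
    (hh : 0 ≤ h) (hg : HypUM g κ) (hw : IsInitialDatum h w₀)
    (hc : criticalSpeed (deriv g 0) h < c)
    (hl : l ∈ Ioo (lambda1 (deriv g 0) h c) (lambda2 (deriv g 0) h c))
    (hφ : IsSemiWavefront g h c φ) (hu : IsClassicalSolution h g w₀ u) :
    -- part A
    ((⨆ s ∈ Icc (-h) 0, lamNorm l (fun x => φ (x + c * s) - w₀ s x)) < ⊤ →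
      ∃ C > 0, ∃ γ > 0, ∀ t, 0 ≤ t → ∀ x,
        |u t x - φ (x + c * t)| / Real.exp (l * (x + c * t)) ≤ C * Real.exp (-(γ * t))) ∧
    -- part B
    (∀ ρ > 0, (∀ v ∈ Icc (κ - ρ) (κ + ρ), DifferentiableAt ℝ g v ∧ |deriv g v| < 1) →
      ∀ b, 0 ≤ b →
      (∀ s ∈ Icc (-h) 0, ∀ x, b - c * h ≤ x →
        w₀ s x ∈ Ico (κ - ρ / 4) (κ + ρ / 4) ∧
        φ (x + c * s) ∈ Ico (κ - ρ / 4) (κ + ρ / 4)) →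
      (∀ s ∈ Icc (-h) 0, ∀ x, x ≤ b →
        |w₀ s x - φ (x + c * s)| ≤ ρ / 2 * Real.exp (l * (x + c * s - b))) →
      IsWavefront g h c κ φ ∧
      ∃ γ > 0, ∀ t, 0 ≤ t → ∀ x,
        |u t x - φ (x + c * t)| / etaWeight l (x + c * t) ≤ ρ / 2 * Real.exp (-(γ * t))) := by
  have hp : 0 ≤ deriv g 0 := by linarith [hg.hypH.one_lt_deriv_zero]
  have hc0 : 0 < c := (criticalSpeed_nonneg hp hh).trans_lt hc
  obtain ⟨hl0, hneg⟩ := charFun0_neg hp hl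
  exact ⟨exponential_stability hh hg hc0 hl0 hneg hφ.toIsWaveProfile hu,
    fun ρ hρ hd b hb hright hleft =>
      wavefront_stability hh hg hw hc0 hl0 hneg hφ.toIsWaveProfile hu hρ hd hb hright hleft⟩
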